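/- Let $R$ be an o-minimal field, i.e. an o-minimal expansion of a real closed field; "definable" means definable in $R$ with parameters, and topological notions refer to the order topology of $R$ and its product topologies. Let $V\subsetneq R$ be a proper convex subring, $\mathfrak m$ its maximal ideal, and $\operatorname{st}\colon V\to V/\mathfrak m$ the residue map, applied coordinatewise on $V^n$. Let $J\subseteq R$ be a nonempty open interval, let $f,g\colon J\to R$ be definable $C^1$ functions with $f<g$ on $J$ such that each of $f'$ and $g'$ has constant sign on $J$ (each is $\ge 0$ throughout $J$ or $\le 0$ throughout $J$), and suppose that the two-dimensional cell $C=\{(x,y): x\in J,\ f(x)<y<g(x)\}$ is contained in $V^2$. Let $h\colon C\to R$ be definable and $C^1$ with $\left|\frac{\partial h}{\partial x_1}\right|<1$ and $\left|\frac{\partial h}{\partial x_2}\right|<1$ on $C$. Then: (1) If $a,b\in C$ and $\operatorname{st}a=\operatorname{st}b$, then $h(a)-h(b)\in\mathfrak m$; in particular $\operatorname{st}h(a)=\operatorname{st}h(b)$ if $h(a)\in V$. (2) If $H\colon\operatorname{cl}C\to R$ is a continuous extension of $h$, then for all $a,b\in\operatorname{cl}C$ with $\operatorname{st}a=\operatorname{st}b$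 we have $H(a)-H(b)\in\mathfrak m$; in particular $\operatorname{st}H(a)=\operatorname{st}H(b)$ if $H(a)\in V$. (3) If moreover the graph of $h$ is contained in $V^3$, then $\operatorname{st}h(a)=\operatorname{st}h(b)$ for all $a,b\in C$ with $\operatorname{st}a=\operatorname{st}b$, and $h$ extends to a continuous definable function $\operatorname{cl}C\to R$. -/

import Mathlib

open Set Filter Topology

universe u v w

namespace ResidueOMin

section OMinimal

/-- A nonempty open interval `(α, β)` of `R`, with endpoints in `R ∪ {-∞, +∞}`. -/
def IsOpenInterval {R : Type w} [LinearOrder R] (J : Set R) : Prop :=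
  J.Nonempty ∧ ∃ α β : WithBot (WithTop R),
    J = {x : R | α < ((x : WithTop R) : WithBot (WithTop R)) ∧
      ((x : WithTop R) : WithBot (WithTop R)) < β}

/-- The `L`-structure `R` is an o-minimal expansion of the ordered field `R`: the order and the
field operations are definable, and every subset of `R` that is definable with parameters is
a finite union of points and open intervals. -/
structure IsOMinimalField (L : FirstOrder.Language.{u, v}) (R : Type w) [Field R] [LinearOrder R]
    [L.Structure R] : Prop where
  definable_lt : (univ : Set R).Definable L {p : Fin 2 → R | p 0 < p 1}
  definable_add : (univ : Set R).Definable L {p : Fin 3 → R | p 2 = p 0 + p 1}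
  definable_mul : (univ : Set R).Definable L {p : Fin 3 → R | p 2 = p 0 * p 1}
  finite_union : ∀ X : Set R, (univ : Set R).Definable₁ L X →
    ∃ S : Set (Set R), S.Finite ∧ (∀ s ∈ S, (∃ a, s = {a}) ∨ IsOpenInterval s) ∧ X = ⋃₀ S

/-- The graph of `h` restricted to `X ⊆ R ^ n`, as a subset of `R ^ (n + 1)`. -/
def graphOn {R : Type w} {n : ℕ} (X : Set (Fin n → R)) (h : (Fin n → R) → R) :
    Set (Fin (n + 1) → R) :=
  {p | Fin.init p ∈ X ∧ p (Fin.last n) = h (Fin.init p)}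

/-- The function `h : X → R`, `X ⊆ R ^ n`, is definable with parameters. Only the values of `h`
on `X` matter. -/
def DefinableFunOn (L : FirstOrder.Language.{u, v}) {R : Type w} [L.Structure R] {n : ℕ}
    (X : Set (Fin n → R)) (h : (Fin n → R) → R) : Prop :=
  (univ : Set R).Definable L (graphOn X h)

/-- The one-variable function `f : J → R`, `J ⊆ R`, is definable with parameters. -/
def DefinableFunOn₁ (L : FirstOrder.Language.{u, v}) {R : Type w} [L.Structure R]
    (J : Set R) (f : R → R) : Prop :=
  DefinableFunOn L {x : Fin 1 → R | x 0 ∈ J} (fun x => f (x 0))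

end OMinimal

section ConvexSubring

variable (R : Type w) [Field R] [LinearOrder R]

/-- A proper convex subring of the ordered field `R`. -/
structure ProperConvexSubring extends Subring R where
  convex : (carrier : Set R).OrdConnected
  proper : (carrier : Set R) ≠ univ

variable {R} [IsStrictOrderedRing R]

/-- A convex subring of an ordered field, viewed as a valuation ring. -/
def ProperConvexSubring.toValuationSubring (V : ProperConvexSubring R) : ValuationSubring R where
  toSubring := V.toSubring
  mem_or_inv_mem' := by
    have key : ∀ x : R, |x| ≤ 1 → x ∈ V.toSubring := fun x hx =>
      V.convex.out (V.toSubring.neg_mem V.toSubring.one_mem) V.toSubring.one_mem (abs_le.mp hx)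
    intro x
    rcases le_total |x| 1 with hx | hx
    · exact Or.inl (key x hx)
    · refine Or.inr (key _ ?_)
      rw [abs_inv]
      exact inv_le_one_of_one_le₀ hx

/-- The standard part map `st : V → k`, where `k = V / 𝔪` is the residue field of `V`. -/
noncomputable def ProperConvexSubring.st (V : ProperConvexSubring R) :
    V.toValuationSubring →+* IsLocalRing.ResidueField V.toValuationSubring :=
  IsLocalRing.residue V.toValuationSubring

/-- The maximal ideal `𝔪` of `V`, as a subset of `R`. -/
def ProperConvexSubring.infinitesimals (V : ProperConvexSubring R) : Set R :=
  {x | ∃ hx : x ∈ V.toValuationSubring,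
    (⟨x, hx⟩ : V.toValuationSubring) ∈ IsLocalRing.maximalIdeal V.toValuationSubring}

/-- `st a = st b` for elements `a`, `b` of `R`: both lie in `V` and their residues agree. -/
def ProperConvexSubring.SameSt (V : ProperConvexSubring R) (a b : R) : Prop :=
  ∃ (ha : a ∈ V.toValuationSubring) (hb : b ∈ V.toValuationSubring),
    V.st ⟨a, ha⟩ = V.st ⟨b, hb⟩

/-- The subset `V ^ n` of `R ^ n`. -/
def ProperConvexSubring.power (V : ProperConvexSubring R) (n : ℕ) : Set (Fin n → R) :=
  {a | ∀ i, a i ∈ V.toValuationSubring}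

end ConvexSubring

section Calculus

variable {R : Type w} [Field R] [LinearOrder R] [TopologicalSpace R]

/-- `f` is differentiable at `x` with derivative `d`, in the order topology of `R`. -/
def HasDerivR (f : R → R) (x d : R) : Prop :=
  Tendsto (fun t => (f t - f x) / (t - x)) (𝓝[≠] x) (𝓝 d)

/-- On the open set `J ⊆ R` the function `f` is `C¹` with derivative `f'`. -/
def IsC1On₁ (J : Set R) (f f' : R → R) : Prop :=
  (∀ x ∈ J, HasDerivR f x (f' x)) ∧ ContinuousOn f' J

/-- On the open set `X ⊆ R ^ n` the function `h` is `C¹` with partial derivatives `h' i`. -/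
def IsC1On {n : ℕ} (X : Set (Fin n → R)) (h : (Fin n → R) → R)
    (h' : Fin n → (Fin n → R) → R) : Prop :=
  (∀ a ∈ X, ∀ i, HasDerivR (fun t => h (Function.update a i t)) (a i) (h' i a)) ∧
    ∀ i, ContinuousOn (h' i) X

/-- `f'` has constant sign on `J`. -/
def ConstantSignOn (J : Set R) (f' : R → R) : Prop :=
  (∀ x ∈ J, 0 ≤ f' x) ∨ (∀ x ∈ J, f' x ≤ 0)

/-- The set `(f, g) ⊆ R ^ 2` of points over `J` strictly between the graphs of `f` and `g`. -/
def cellBetween (J : Set R) (f g : R → R) : Set (Fin 2 → R) :=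
  {p | p 0 ∈ J ∧ f (p 0) < p 1 ∧ p 1 < g (p 0)}

/-- `J`, `f`, `g` are the data of a cell `(f, g)` of dimension two in `R ^ 2`. -/
structure IsTwoCell (L : FirstOrder.Language.{u, v}) [L.Structure R] (J : Set R) (f g : R → R) :
    Prop where
  isOpenInterval : IsOpenInterval J
  definable_lower : DefinableFunOn₁ L J f
  definable_upper : DefinableFunOn₁ L J g
  continuousOn_lower : ContinuousOn f J
  continuousOn_upper : ContinuousOn g J
  lt : ∀ x ∈ J, f x < g x

end Calculus

end ResidueOMin

set_option linter.unusedSectionVars false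

namespace ResidueOMin

/-! ### Closure properties of definable sets and functions -/

section Definability

/-! All three parts follow from one estimate: `h` is `1`-Lipschitz on `C` for the `ℓ¹` distance
(`IsTwoCell.abs_sub_le_sumDist`). If `st a = st b`, the distance of `a` and `b` is a finite sum of
elements of `𝔪`, and convexity of `𝔪` gives (1). A continuous extension satisfies the same
inequality on `cl C`, which gives (2). In (3), `h a` lies in `V`, and the extension is McShane's, `H
p = inf_q (h q + d(p, q))`; the infimum exists because definable sets bounded below have one
(`IsOMinimalField.exists_isGLB`).

For the Lipschitz estimate, two points of `C` are joined inside `C` by a path whose `ℓ¹` length is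
their `ℓ¹` distance. By the sign hypotheses `f` and `g` are monotone. If one increases and the other
decreases, one horizontal and one vertical segment suffice. If both increase, this still works
unless the right-hand point is the higher one; then the path follows an increasing curve in `C` that
keeps a fixed relative height between `f` and `g`, capped at the final height. Two decreasing bounds
reduce to this by reflection.

Since `R` need not be Dedekind complete, both the mean value inequality and the estimate along the
curve rest on the fact that a locally increasing definable function is increasing
(`IsOMinimalField.le_of_locally_increasing`). -/

theorem definableFunOn_domain {L : FirstOrder.Language.{u, v}} {R : Type w} [L.Structure R]
    {n : ℕ} {X : Set (Fin n → R)} {h : (Fin n → R) → R} (hX : DefinableFunOn L X h) :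
    (univ : Set R).Definable L X := by
  have h1 := Set.Definable.preimage_comp
    (Fin.snoc (α := fun _ => Fin n ⊕ Fin 1) Sum.inl (Sum.inr 0)) hX
  have h2 : X = {v : Fin n → R | ∃ u : Fin 1 → R, Sum.elim v u ∈
      (fun g : Fin n ⊕ Fin 1 → R =>
        g ∘ Fin.snoc (α := fun _ => Fin n ⊕ Fin 1) Sum.inl (Sum.inr 0)) ⁻¹' graphOn X h} := by
    have key : ∀ (v : Fin n → R) (u : Fin 1 → R),
        Fin.init (Sum.elim v u ∘ Fin.snoc (α := fun _ => Fin n ⊕ Fin 1) Sum.inl (Sum.inr 0))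
          = v := by
      intro v u
      funext i
      simp [Fin.init]
    ext v
    constructor
    · intro hv
      refine ⟨fun _ => h v, ?_⟩
      simp only [mem_preimage, graphOn, mem_ofPred_eq, key]
      exact ⟨hv, by simp⟩
    · rintro ⟨u, hu⟩
      have := hu.1
      rwa [key] at this
  rw [h2]
  exact Set.Definable.exists_of_finite h1

variable {L : FirstOrder.Language.{u, v}} {R : Type w} [Field R] [LinearOrder R]
  [L.Structure R] {α : Type*}

/-- Extension by `0` off `X` replaces a partial definable function by a total one, which can be
composed with other definable maps. -/
theorem DefinableFunOn.indicator {R : Type w} [Field R] [L.Structure R] {n : ℕ} {X : Set (Fin n → R)} {h : (Fin n → R) → R}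
    (hX : DefinableFunOn L X h) : (univ : Set R).DefinableFun L (X.indicator h) := by
  have h1 := Set.Definable.preimage_comp
    (Fin.snoc (α := fun _ => Option (Fin n)) some none) hX
  have h2 := ((definableFunOn_domain hX).preimage_comp (some : Fin n → Option (Fin n))).compl
  have h3 : (univ : Set R).Definable L {w : Option (Fin n) → R | w none = 0} :=
    Set.DefinableFun.ofPred_eq_const (Set.DefinableFun.proj L) (mem_univ 0)
  have key : Function.tupleGraph (X.indicator h) =
      ((fun g : Option (Fin n) → R => g ∘ Fin.snoc (α := fun _ => Option (Fin n)) some none) ⁻¹'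
        graphOn X h) ∪ (((fun g : Option (Fin n) → R => g ∘ some) ⁻¹' X)ᶜ ∩ {w | w none = 0}) := by
    have hinit : ∀ w : Option (Fin n) → R,
        Fin.init (w ∘ Fin.snoc (α := fun _ => Option (Fin n)) some none) = w ∘ some := by
      intro w
      funext i
      simp [Fin.init]
    ext w
    simp only [Function.tupleGraph, graphOn, mem_union, mem_inter_iff, mem_compl_iff, mem_preimage,
      mem_ofPred_eq, hinit, Function.comp_apply, Fin.snoc_last]
    by_cases hw : w ∘ some ∈ X
    · simp [hw, eq_comm]
    · simp [hw, eq_comm]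
  unfold Set.DefinableFun
  rw [key]
  exact h1.union (h2.inter h3)

namespace IsOMinimalField

variable {F G : (α → R) → R}

theorem definable_setOf_lt (hR : IsOMinimalField L R) (hF : (univ : Set R).DefinableFun L F)
    (hG : (univ : Set R).DefinableFun L G) :
    (univ : Set R).Definable L {v | F v < G v} := by
  have hM : (univ : Set R).DefinableMap L (fun v => ![F v, G v]) := by
    simp [Set.DefinableMap, hF, hG]
  exact hR.definable_lt.preimage_map hM

theorem definable_setOf_le (hR : IsOMinimalField L R) (hF : (univ : Set R).DefinableFun L F)
    (hG : (univ : Set R).DefinableFun L G) :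
    (univ : Set R).Definable L {v | F v ≤ G v} := by
  have := (hR.definable_setOf_lt hG hF).compl
  simpa [compl_def] using this

end IsOMinimalField

theorem definableFun_binary {R : Type w} [L.Structure R] {F G : (α → R) → R}
    {S : Set (Fin 3 → R)} (hS : (univ : Set R).Definable L S) {φ : R → R → R}
    (hφ : S = {p | p 2 = φ (p 0) (p 1)})
    (hF : (univ : Set R).DefinableFun L F) (hG : (univ : Set R).DefinableFun L G) :
    (univ : Set R).DefinableFun L (fun v => φ (F v) (G v)) := by
  have hpair : (univ : Set R).DefinableFun L (fun p : Fin 2 → R => φ (p 0) (p 1)) := by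
    have := hS.preimage_comp (![some 0, some 1, none] : Fin 3 → Option (Fin 2))
    have h2 : Function.tupleGraph (fun p : Fin 2 → R => φ (p 0) (p 1)) =
        (fun g : Option (Fin 2) → R => g ∘ ![some 0, some 1, none]) ⁻¹' S := by
      ext p
      simp [Function.tupleGraph, hφ, eq_comm]
    unfold Set.DefinableFun
    rwa [h2]
  have hM : (univ : Set R).DefinableMap L (fun v => ![F v, G v]) := by
    simp [Set.DefinableMap, hF, hG]
  exact Set.DefinableFun.comp hM hpair

namespace IsOMinimalField

variable {F G : (α → R) → R}

theorem definableFun_add (hR : IsOMinimalField L R) (hF : (univ : Set R).DefinableFun L F)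
    (hG : (univ : Set R).DefinableFun L G) :
    (univ : Set R).DefinableFun L (fun v => F v + G v) :=
  definableFun_binary hR.definable_add rfl hF hG

theorem definableFun_mul (hR : IsOMinimalField L R) (hF : (univ : Set R).DefinableFun L F)
    (hG : (univ : Set R).DefinableFun L G) :
    (univ : Set R).DefinableFun L (fun v => F v * G v) :=
  definableFun_binary hR.definable_mul rfl hF hG

theorem definableFun_const_mul (hR : IsOMinimalField L R) (c : R)
    (hF : (univ : Set R).DefinableFun L F) :
    (univ : Set R).DefinableFun L (fun v => c * F v) :=
  hR.definableFun_mul (L.definableFun_const α (mem_univ c)) hF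

theorem definableFun_neg (hR : IsOMinimalField L R) (hF : (univ : Set R).DefinableFun L F) :
    (univ : Set R).DefinableFun L (fun v => - F v) := by
  simpa using hR.definableFun_const_mul (-1) hF

theorem definableFun_sub (hR : IsOMinimalField L R) (hF : (univ : Set R).DefinableFun L F)
    (hG : (univ : Set R).DefinableFun L G) :
    (univ : Set R).DefinableFun L (fun v => F v - G v) := by
  simpa [sub_eq_add_neg] using hR.definableFun_add hF (hR.definableFun_neg hG)

open Classical in
theorem definableFun_min (hR : IsOMinimalField L R) (hF : (univ : Set R).DefinableFun L F)
    (hG : (univ : Set R).DefinableFun L G) :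
    (univ : Set R).DefinableFun L (fun v => min (F v) (G v)) := by
  have := Set.DefinableFun.ite (p := fun v => F v ≤ G v) (hR.definable_setOf_le hF hG) hF hG
  convert! this using 2 with v
  exact min_def _ _

open Classical in
theorem definableFun_abs (hR : IsOMinimalField L R) [IsStrictOrderedRing R]
    (hF : (univ : Set R).DefinableFun L F) :
    (univ : Set R).DefinableFun L (fun v => |F v|) := by
  have := Set.DefinableFun.ite (p := fun v => 0 ≤ F v)
    (hR.definable_setOf_le (L.definableFun_const α (mem_univ 0)) hF) hF (hR.definableFun_neg hF)
  convert! this using 2 with v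
  split_ifs with h0
  · exact abs_of_nonneg h0
  · exact abs_of_neg (not_le.1 h0)

end IsOMinimalField
end Definability

/-! ### Definable completeness and passage from local to global -/

section Completeness

variable {R : Type w} [Field R] [LinearOrder R] [IsStrictOrderedRing R]

theorem IsOpenInterval.exists_isGLB {J : Set R} (hJ : IsOpenInterval J) (hb : BddBelow J) :
    ∃ a, IsGLB J a := by
  obtain ⟨⟨x, hx⟩, α, β, rfl⟩ := hJ
  obtain ⟨m, hm⟩ := hb
  have hlt : ∀ a b : R, a < b → ((a : WithTop R) : WithBot (WithTop R)) < ((b : WithTop R) :) :=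
    fun a b hab => WithBot.coe_lt_coe.2 (WithTop.coe_lt_coe.2 hab)
  induction α using WithBot.recBotCoe with
  | bot =>
    exfalso
    have h1 : m - 1 < x := by linarith [hm hx]
    have := hm (show m - 1 ∈ _ from ⟨WithBot.bot_lt_coe _, (hlt _ _ h1).trans hx.2⟩)
    linarith
  | coe α =>
    induction α using WithTop.recTopCoe with
    -- The type of endpoints allows a left endpoint `+∞`; nonemptiness excludes it.
    | top => exact absurd (WithBot.coe_lt_coe.1 hx.1) not_top_lt
    | coe a =>
      have hax : a < x := WithTop.coe_lt_coe.1 (WithBot.coe_lt_coe.1 hx.1)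
      refine ⟨a, fun y hy => (WithTop.coe_lt_coe.1 (WithBot.coe_lt_coe.1 hy.1)).le, ?_⟩
      intro b hb
      by_contra! hab
      obtain ⟨y, h1, h2⟩ := exists_between (lt_min hab hax)
      have := hb (show y ∈ _ from ⟨hlt _ _ h1, (hlt _ _ (h2.trans_le (min_le_right _ _))).trans hx.2⟩)
      exact absurd (h2.trans_le (min_le_left _ _)) this.not_gt

theorem IsOMinimalField.exists_isGLB {L : FirstOrder.Language.{u, v}} [L.Structure R]
    (hR : IsOMinimalField L R) {X : Set R} (hX : (univ : Set R).Definable₁ L X)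
    (hne : X.Nonempty) (hb : BddBelow X) : ∃ a, IsGLB X a := by
  obtain ⟨S, hS, hS', rfl⟩ := hR.finite_union X hX
  clear hX
  induction S, hS using Set.Finite.induction_on with
  | empty => simp at hne
  | @insert s S _ _ ih =>
    rw [sUnion_insert] at hne hb ⊢
    have hs : ∃ a, IsGLB s a := by
      rcases hS' s (mem_insert _ _) with ⟨a, rfl⟩ | hs
      · exact ⟨a, isGLB_singleton⟩
      · exact hs.exists_isGLB (hb.mono subset_union_left)
    rcases (⋃₀ S).eq_empty_or_nonempty with h0 | h0
    · simpa [h0] using hs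
    · obtain ⟨a, ha⟩ := hs
      obtain ⟨b, hb⟩ := ih (fun t ht => hS' t (mem_insert_of_mem _ ht)) h0
        (hb.mono subset_union_right)
      exact ⟨_, ha.union hb⟩

/-- A definable set that contains the left end of an interval, and is closed and open to the right,
contains the right end. -/
theorem IsOMinimalField.mem_of_inductive {L : FirstOrder.Language.{u, v}} [L.Structure R]
    (hR : IsOMinimalField L R) {D : Set R} (hD : (univ : Set R).Definable₁ L D) {a b : R}
    (hab : a ≤ b) (ha : a ∈ D)
    (hclosed : ∀ x, a < x → x ≤ b → (∀ y, a ≤ y → y < x → y ∈ D) → x ∈ D)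
    (hopen : ∀ x, a ≤ x → x < b → x ∈ D → ∃ z > x, ∀ y, x < y → y < z → y ≤ b → y ∈ D) :
    b ∈ D := by
  by_contra hbD
  have hX : (univ : Set R).Definable₁ L (Dᶜ ∩ Ici a) := by
    have h1 : (univ : Set R).Definable L {x : Fin 1 → R | a ≤ x 0} :=
      hR.definable_setOf_le (L.definableFun_const _ (mem_univ a)) (Set.DefinableFun.proj L)
    exact (Set.Definable.compl hD).inter h1
  -- Here `x` is the infimum of the points right of `a` missing from `D`. Closedness puts `x` in
  -- `D`; openness then yields a larger lower bound.
  obtain ⟨x, hx⟩ := hR.exists_isGLB hX ⟨b, hbD, hab⟩ ⟨a, fun y hy => hy.2⟩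
  have hax : a ≤ x := hx.2 fun y hy => hy.2
  have hxb : x ≤ b := hx.1 ⟨hbD, hab⟩
  have hlow : ∀ y, a ≤ y → y < x → y ∈ D := fun y h1 h2 => by
    by_contra h3
    exact absurd (hx.1 ⟨h3, h1⟩) h2.not_ge
  have hxD : x ∈ D := by
    rcases hax.eq_or_lt with rfl | hax'
    · exact ha
    · exact hclosed x hax' hxb hlow
  have hxb' : x < b := lt_of_le_of_ne hxb fun h => hbD (h ▸ hxD)
  obtain ⟨z, hz, hzD⟩ := hopen x hax hxb' hxD
  have : min z b ≤ x := by
    refine hx.2 fun y hy => ?_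
    by_contra! h
    have hyz := h.trans_le (min_le_left z b)
    have hyb := h.trans_le (min_le_right z b)
    rcases lt_trichotomy y x with h1 | rfl | h1
    · exact hy.1 (hlow y hy.2 h1)
    · exact hy.1 hxD
    · exact hy.1 (hzD y h1 hyz hyb.le)
  exact absurd this (lt_min hz hxb').not_ge

/-- A locally increasing definable function is increasing. -/
theorem IsOMinimalField.le_of_locally_increasing {L : FirstOrder.Language.{u, v}} [L.Structure R]
    [TopologicalSpace R] [OrderTopology R]
    (hR : IsOMinimalField L R) {F : R → R}
    (hF : (univ : Set R).DefinableFun L (fun v : Fin 1 → R => F (v 0))) {a b : R} (hab : a ≤ b)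
    (hloc : ∀ x ∈ Icc a b, ∀ᶠ t in 𝓝 x, t ∈ Icc a b →
      (x ≤ t → F x ≤ F t) ∧ (t ≤ x → F t ≤ F x)) : F a ≤ F b := by
  have hD : (univ : Set R).Definable₁ L {x | F a ≤ F x} :=
    hR.definable_setOf_le (L.definableFun_const _ (mem_univ (F a))) hF
  refine hR.mem_of_inductive hD hab le_rfl ?_ ?_
  · intro x hax hxb hlow
    have h1 := (hloc x ⟨hax.le, hxb⟩)
    obtain ⟨l, hl, hl'⟩ := exists_Ioc_subset_of_mem_nhds h1 ⟨a, hax⟩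
    obtain ⟨t, ht1, ht2⟩ := exists_between (max_lt hl hax)
    have hat : a ≤ t := (le_max_right _ _).trans ht1.le
    exact (hlow t hat ht2).trans
      ((hl' ⟨(le_max_left _ _).trans_lt ht1, ht2.le⟩ ⟨hat, ht2.le.trans hxb⟩).2 ht2.le)
  · intro x hax hxb hx
    obtain ⟨z, hz, hz'⟩ := exists_Ico_subset_of_mem_nhds (hloc x ⟨hax, hxb.le⟩) ⟨b, hxb⟩
    refine ⟨z, hz, fun y h1 h2 h3 => le_trans (show F a ≤ F x from hx) ?_⟩
    exact (hz' ⟨h1.le, h2⟩ ⟨hax.trans h1.le, h3⟩).1 h1.le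

end Completeness
-- Mean value inequalities
section Calculus

variable {L : FirstOrder.Language.{u, v}} {R : Type w} [Field R] [LinearOrder R]
  [IsStrictOrderedRing R] [TopologicalSpace R] [OrderTopology R] [L.Structure R]

theorem HasDerivR.eventually_sub_le {R : Type w} [Field R] [LinearOrder R]
    [IsStrictOrderedRing R] [TopologicalSpace R] [OrderTopology R]
    {φ : R → R} {x d c : R} (h : HasDerivR φ x d) (hd : d < c) :
    ∀ᶠ t in 𝓝 x, (x ≤ t → φ t - φ x ≤ c * (t - x)) ∧ (t ≤ x → φ x - φ t ≤ c * (x - t)) := by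
  have h1 : ∀ᶠ t in 𝓝[≠] x, (φ t - φ x) / (t - x) < c := h.eventually_lt_const hd
  rw [eventually_nhdsWithin_iff] at h1
  filter_upwards [h1] with t ht
  rcases lt_trichotomy t x with h2 | rfl | h2
  · have h3 := ht h2.ne
    rw [div_lt_iff_of_neg (sub_neg.2 h2)] at h3
    exact ⟨fun h => absurd h h2.not_ge, fun _ => by linarith⟩
  · simp
  · have h3 := ht h2.ne'
    rw [div_lt_iff₀ (sub_pos.2 h2)] at h3
    exact ⟨fun _ => h3.le, fun h => absurd h h2.not_ge⟩

theorem HasDerivR.neg {R : Type w} [Field R] [LinearOrder R]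
    [IsStrictOrderedRing R] [TopologicalSpace R] [OrderTopology R] {φ : R → R} {x d : R}
    (h : HasDerivR φ x d) : HasDerivR (fun t => - φ t) x (-d) := by
  refine (Filter.Tendsto.neg h).congr fun t => ?_
  rw [← neg_div]
  congr 1
  ring

/-- The strict bound makes `c * x - φ x` locally increasing on `[a, b]`. Two functions occur because
definability is known for the extension `φ` by zero, differentiability for the original `ψ`. -/
theorem IsOMinimalField.sub_le_of_hasDerivR_lt (hR : IsOMinimalField L R) {φ ψ d : R → R}
    {a b c : R} (hφ : (univ : Set R).DefinableFun L (fun v : Fin 1 → R => φ (v 0)))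
    (hab : a ≤ b) (heq : EqOn φ ψ (Icc a b)) (hd : ∀ x ∈ Icc a b, HasDerivR ψ x (d x))
    (hc : ∀ x ∈ Icc a b, d x < c) : ψ b - ψ a ≤ c * (b - a) := by
  have hF : (univ : Set R).DefinableFun L (fun v : Fin 1 → R => c * v 0 - φ (v 0)) :=
    hR.definableFun_sub (hR.definableFun_const_mul c (Set.DefinableFun.proj L)) hφ
  have key := hR.le_of_locally_increasing (F := fun x => c * x - φ x) hF hab ?_
  · rw [heq (left_mem_Icc.2 hab), heq (right_mem_Icc.2 hab)] at key
    linarith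
  · intro x hx
    filter_upwards [(hd x hx).eventually_sub_le (hc x hx)] with t ht htI
    simp only [heq hx, heq htI]
    exact ⟨fun h => by linarith [ht.1 h], fun h => by linarith [ht.2 h]⟩

theorem IsOMinimalField.le_sub_of_lt_hasDerivR (hR : IsOMinimalField L R) {φ ψ d : R → R}
    {a b c : R} (hφ : (univ : Set R).DefinableFun L (fun v : Fin 1 → R => φ (v 0)))
    (hab : a ≤ b) (heq : EqOn φ ψ (Icc a b)) (hd : ∀ x ∈ Icc a b, HasDerivR ψ x (d x))
    (hc : ∀ x ∈ Icc a b, c < d x) : c * (b - a) ≤ ψ b - ψ a := by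
  have := hR.sub_le_of_hasDerivR_lt (φ := fun x => - φ x) (ψ := fun x => - ψ x)
    (d := fun x => - d x) (c := -c) (hR.definableFun_neg hφ) hab
    (fun x hx => congrArg Neg.neg (heq hx)) (fun x hx => (hd x hx).neg)
    (fun x hx => neg_lt_neg (hc x hx))
  linarith

theorem le_of_forall_pos_le_add_mul {R : Type w} [Field R] [LinearOrder R]
    [IsStrictOrderedRing R] {x y z : R} (hz : 0 ≤ z)
    (h : ∀ ε > 0, x ≤ y + ε * z) : x ≤ y := by
  refine le_of_forall_pos_le_add fun ε hε => (h (ε / (z + 1)) (by positivity)).trans ?_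
  gcongr
  rw [div_mul_eq_mul_div, div_le_iff₀ (by positivity)]
  nlinarith

theorem IsOMinimalField.monotoneOn_of_hasDerivR_nonneg (hR : IsOMinimalField L R) {J : Set R}
    (hJ : J.OrdConnected) {f f' : R → R}
    (hf : (univ : Set R).DefinableFun L (fun v : Fin 1 → R => J.indicator f (v 0)))
    (hd : ∀ x ∈ J, HasDerivR f x (f' x)) (h0 : ∀ x ∈ J, 0 ≤ f' x) : MonotoneOn f J := by
  intro a ha b hb hab
  have hI := hJ.out ha hb
  -- The mean value inequality needs a strict bound on the derivative, so the slope `0` is relaxed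
  -- to `-ε`.
  refine le_of_forall_pos_le_add_mul (sub_nonneg.2 hab) fun ε hε => ?_
  have := hR.le_sub_of_lt_hasDerivR (φ := J.indicator f) (ψ := f) (d := f') (c := -ε) hf hab
    (fun x hx => indicator_of_mem (hI hx) f) (fun x hx => hd x (hI hx))
    (fun x hx => by linarith [h0 x (hI hx)])
  linarith

theorem IsOMinimalField.antitoneOn_of_hasDerivR_nonpos (hR : IsOMinimalField L R) {J : Set R}
    (hJ : J.OrdConnected) {f f' : R → R}
    (hf : (univ : Set R).DefinableFun L (fun v : Fin 1 → R => J.indicator f (v 0)))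
    (hd : ∀ x ∈ J, HasDerivR f x (f' x)) (h0 : ∀ x ∈ J, f' x ≤ 0) : AntitoneOn f J := by
  intro a ha b hb hab
  have hI := hJ.out ha hb
  refine le_of_forall_pos_le_add_mul (sub_nonneg.2 hab) fun ε hε => ?_
  have := hR.sub_le_of_hasDerivR_lt (φ := J.indicator f) (ψ := f) (d := f') (c := ε) hf hab
    (fun x hx => indicator_of_mem (hI hx) f) (fun x hx => hd x (hI hx))
    (fun x hx => by linarith [h0 x (hI hx)])
  linarith

/-- Partial derivatives bounded by `1` make a definable function `1`-Lipschitz on the segments of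
`X` that are parallel to an axis. -/
theorem IsOMinimalField.abs_update_sub_le (hR : IsOMinimalField L R) {n : ℕ}
    {X : Set (Fin n → R)} {h : (Fin n → R) → R} {h' : Fin n → (Fin n → R) → R}
    (hdef : DefinableFunOn L X h)
    (hd : ∀ a ∈ X, ∀ i, HasDerivR (fun t => h (Function.update a i t)) (a i) (h' i a))
    (hlt : ∀ a ∈ X, ∀ i, |h' i a| < 1) (p : Fin n → R) (i : Fin n) {s t : R} (hst : s ≤ t)
    (hX : ∀ u ∈ Icc s t, Function.update p i u ∈ X) :
    |h (Function.update p i t) - h (Function.update p i s)| ≤ t - s := by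
  have hφ : (univ : Set R).DefinableFun L
      (fun v : Fin 1 → R => X.indicator h (Function.update p i (v 0))) := by
    refine Set.DefinableFun.comp (fun j => ?_) hdef.indicator
    rcases eq_or_ne j i with rfl | hj
    · simpa using Set.DefinableFun.proj L
    · simpa [hj] using L.definableFun_const _ (mem_univ (p j))
  have heq : EqOn (fun u => X.indicator h (Function.update p i u))
      (fun u => h (Function.update p i u)) (Icc s t) :=
    fun u hu => indicator_of_mem (hX u hu) h
  have hder : ∀ u ∈ Icc s t, HasDerivR (fun u => h (Function.update p i u)) u
      (h' i (Function.update p i u)) := fun u hu => by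
    simpa using hd _ (hX u hu) i
  have h1 := hR.sub_le_of_hasDerivR_lt (c := 1) hφ hst heq hder
    (fun u hu => (abs_lt.1 (hlt _ (hX u hu) i)).2)
  have h2 := hR.le_sub_of_lt_hasDerivR (c := -1) hφ hst heq hder
    (fun u hu => (abs_lt.1 (hlt _ (hX u hu) i)).1)
  exact abs_le.2 ⟨by linarith, by linarith⟩

end Calculus

/-! ### Paths in a cell and the Lipschitz estimate -/

section Cell

variable {R : Type w} [Field R] [LinearOrder R]

/-- `k` is `1`-Lipschitz on the horizontal and vertical segments in the cell `(f, g)` over `J`. -/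
structure LipschitzOnSegments (J : Set R) (f g : R → R) (k : R → R → R) : Prop where
  horizontal : ∀ x x' y, x ≤ x' → (∀ u ∈ Icc x x', u ∈ J ∧ f u < y ∧ y < g u) →
    |k x' y - k x y| ≤ x' - x
  vertical : ∀ x ∈ J, ∀ y y', y ≤ y' → f x < y → y' < g x → |k x y' - k x y| ≤ y' - y

variable [IsStrictOrderedRing R]

namespace LipschitzOnSegments

variable {J : Set R} {f g : R → R} {k : R → R → R}

/-- The reflection `y ↦ -y` swaps the two bounds and turns decreasing ones into increasing ones. -/
theorem reflect (hk : LipschitzOnSegments J f g k) :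
    LipschitzOnSegments J (fun x => - g x) (fun x => - f x) (fun x y => k x (-y)) where
  horizontal x x' y hx hu := hk.horizontal x x' (-y) hx fun u h =>
    ⟨(hu u h).1, by linarith [(hu u h).2.2], by linarith [(hu u h).2.1]⟩
  vertical x hx y y' hy h1 h2 := by
    have := hk.vertical x hx (-y') (-y) (by linarith) (by linarith) (by linarith)
    rw [abs_sub_comm] at this
    linarith

theorem abs_sub_le_of_mem (hk : LipschitzOnSegments J f g k) {x y y' : R} (hx : x ∈ J)
    (h1 : f x < y) (h2 : y < g x) (h3 : f x < y') (h4 : y' < g x) :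
    |k x y' - k x y| ≤ |y' - y| := by
  rcases le_total y y' with h | h
  · exact (hk.vertical x hx y y' h h1 h4).trans (le_abs_self _)
  · rw [abs_sub_comm, abs_sub_comm y']
    exact (hk.vertical x hx y' y h h3 h2).trans (le_abs_self _)

/-- The horizontal, then vertical path. -/
theorem abs_sub_le_right (hk : LipschitzOnSegments J f g k) {x x' y y' : R} (hxx : x ≤ x')
    (hu : ∀ u ∈ Icc x x', u ∈ J ∧ f u < y ∧ y < g u) (h1 : f x' < y') (h2 : y' < g x') :
    |k x' y' - k x y| ≤ (x' - x) + |y' - y| := by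
  obtain ⟨h3, h4, h5⟩ := hu x' (right_mem_Icc.2 hxx)
  have e1 := hk.horizontal x x' y hxx hu
  have e2 := hk.abs_sub_le_of_mem h3 h4 h5 h1 h2
  have := abs_sub_le (k x' y') (k x' y) (k x y)
  linarith

/-- The vertical, then horizontal path. -/
theorem abs_sub_le_left (hk : LipschitzOnSegments J f g k) {x x' y y' : R} (hxx : x ≤ x')
    (hu : ∀ u ∈ Icc x x', u ∈ J ∧ f u < y' ∧ y' < g u) (h1 : f x < y) (h2 : y < g x) :
    |k x' y' - k x y| ≤ (x' - x) + |y' - y| := by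
  obtain ⟨h3, h4, h5⟩ := hu x (left_mem_Icc.2 hxx)
  have e1 := hk.horizontal x x' y' hxx hu
  have e2 := hk.abs_sub_le_of_mem h3 h1 h2 h4 h5
  have := abs_sub_le (k x' y') (k x y') (k x y)
  linarith

variable [TopologicalSpace R] [OrderTopology R] {L : FirstOrder.Language.{u, v}} [L.Structure R]

/-- The change of `k` along an increasing curve is at most the length of the curve. -/
theorem abs_sub_le_of_curve (hk : LipschitzOnSegments J f g k) (hR : IsOMinimalField L R)
    (hJ : J.OrdConnected) (hf : MonotoneOn f J) (hg : MonotoneOn g J)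
    (hfc : ContinuousOn f J) (hgc : ContinuousOn g J)
    (hkdef : (univ : Set R).DefinableFun L (fun v : Fin 2 → R => k (v 0) (v 1)))
    {c : R → R} (hcdef : (univ : Set R).DefinableFun L (fun v : Fin 1 → R => c (v 0)))
    {a b : R} (ha : a ∈ J) (hb : b ∈ J) (hab : a ≤ b) (hc : MonotoneOn c (Icc a b))
    (hfcg : ∀ x ∈ Icc a b, f x < c x ∧ c x < g x) :
    |k b (c b) - k a (c a)| ≤ (b - a) + (c b - c a) := by
  have hI := hJ.out ha hb
  have hkc : (univ : Set R).DefinableFun L (fun v : Fin 1 → R => k (v 0) (c (v 0))) := by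
    have hM : (univ : Set R).DefinableMap L (fun v : Fin 1 → R => ![v 0, c (v 0)]) := by
      simp [Set.DefinableMap, hcdef, Set.DefinableFun.proj]
    exact Set.DefinableFun.comp hM hkdef
  have hlen : (univ : Set R).DefinableFun L (fun v : Fin 1 → R => v 0 + c (v 0)) :=
    hR.definableFun_add (Set.DefinableFun.proj L) hcdef
  have hloc : ∀ x ∈ Icc a b, ∀ᶠ t in 𝓝 x, t ∈ Icc a b →
      (x ≤ t → |k t (c t) - k x (c x)| ≤ (t - x) + (c t - c x)) ∧
      (t ≤ x → |k x (c x) - k t (c t)| ≤ (x - t) + (c x - c t)) := by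
    intro x hx
    -- For `t` near `x` the corner `(t, c x)` lies in the cell, and monotonicity of `f` and `g`
    -- keeps the horizontal segment at height `c x` inside. Continuity of `c` is not needed.
    have e1 := (hfc x (hI hx)).eventually_lt_const (hfcg x hx).1
    have e2 := (hgc x (hI hx)).eventually_const_lt (hfcg x hx).2
    rw [eventually_nhdsWithin_iff] at e1 e2
    filter_upwards [e1, e2] with t h1 h2 ht
    replace h1 := h1 (hI ht)
    replace h2 := h2 (hI ht)
    constructor
    · intro hxt
      have := hk.abs_sub_le_right (y := c x) (y' := c t) hxt (fun u hu => ?_)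
        (hfcg t ht).1 (hfcg t ht).2
      · rwa [abs_of_nonneg (sub_nonneg.2 (hc hx ht hxt))] at this
      · have huJ : u ∈ J := hJ.out (hI hx) (hI ht) hu
        exact ⟨huJ, (hf huJ (hI ht) hu.2).trans_lt h1,
          (hfcg x hx).2.trans_le (hg (hI hx) huJ hu.1)⟩
    · intro htx
      have := hk.abs_sub_le_left (y := c t) (y' := c x) htx (fun u hu => ?_)
        (hfcg t ht).1 (hfcg t ht).2
      · rwa [abs_of_nonneg (sub_nonneg.2 (hc ht hx htx))] at this
      · have huJ : u ∈ J := hJ.out (hI ht) (hI hx) hu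
        exact ⟨huJ, (hf huJ (hI hx) hu.2).trans_lt (hfcg x hx).1,
          h2.trans_le (hg (hI ht) huJ hu.1)⟩
  -- Up to a constant, `x + c x` is the `ℓ¹` length of the curve; length minus `k` and length plus
  -- `k` both increase, which bounds the change of `k` from both sides.
  have h1 := hR.le_of_locally_increasing (F := fun x => x + c x - k x (c x))
    (hR.definableFun_sub hlen hkc) hab fun x hx => (hloc x hx).mono fun t h ht =>
      ⟨fun hxt => by linarith [(abs_le.1 ((h ht).1 hxt)).2],
        fun hxt => by linarith [(abs_le.1 ((h ht).2 hxt)).2]⟩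
  have h2 := hR.le_of_locally_increasing (F := fun x => x + c x + k x (c x))
    (hR.definableFun_add hlen hkc) hab fun x hx => (hloc x hx).mono fun t h ht =>
      ⟨fun hxt => by linarith [(abs_le.1 ((h ht).1 hxt)).1],
        fun hxt => by linarith [(abs_le.1 ((h ht).2 hxt)).1]⟩
  exact abs_le.2 ⟨by linarith, by linarith⟩

theorem abs_sub_le_of_monotoneOn (hk : LipschitzOnSegments J f g k) (hR : IsOMinimalField L R)
    (hJ : J.OrdConnected) (hf : MonotoneOn f J) (hg : MonotoneOn g J)
    (hfc : ContinuousOn f J) (hgc : ContinuousOn g J)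
    (hfdef : (univ : Set R).DefinableFun L (fun v : Fin 1 → R => f (v 0)))
    (hgdef : (univ : Set R).DefinableFun L (fun v : Fin 1 → R => g (v 0)))
    (hkdef : (univ : Set R).DefinableFun L (fun v : Fin 2 → R => k (v 0) (v 1)))
    (hfg : ∀ x ∈ J, f x < g x)
    {x x' y y' : R} (hx : x ∈ J) (hx' : x' ∈ J) (hxx : x ≤ x')
    (h1 : f x < y) (h2 : y < g x) (h3 : f x' < y') (h4 : y' < g x') :
    |k x' y' - k x y| ≤ (x' - x) + |y' - y| := by
  have hI := hJ.out hx hx'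
  have hxI := left_mem_Icc.2 hxx
  have hxI' := right_mem_Icc.2 hxx
  rcases le_or_gt y' y with hy | hy
  · refine hk.abs_sub_le_right hxx (fun u hu => ⟨hI hu, ?_, ?_⟩) h3 h4
    · linarith [hf (hI hu) hx' hu.2]
    · linarith [hg hx (hI hu) hu.1]
  -- The relative height of `y` in the fibre over `x`.
  obtain ⟨s, hs⟩ : ∃ s, s = (y - f x) / (g x - f x) := ⟨_, rfl⟩
  have hpos : 0 < g x - f x := sub_pos.2 (hfg x hx)
  have hs0 : 0 < s := hs ▸ div_pos (sub_pos.2 h1) hpos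
  have hs1 : s < 1 := by
    rw [hs, div_lt_one hpos]
    linarith
  have hsx : f x + s * (g x - f x) = y := by
    rw [hs, div_mul_cancel₀ _ hpos.ne']
    ring
  -- The cap at `y'` makes the last vertical segment go upwards, so the total vertical length is `y'
  -- - y`. The capped curve stays above `f` because `f u ≤ f x' < y'`.
  set c : R → R := fun u => min (f u + s * (g u - f u)) y' with hc
  have hcx : c x = y := by simp only [hc, hsx, min_eq_left hy.le]
  have hcdef : (univ : Set R).DefinableFun L (fun v : Fin 1 → R => c (v 0)) :=
    hR.definableFun_min (hR.definableFun_add hfdef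
      (hR.definableFun_const_mul s (hR.definableFun_sub hgdef hfdef)))
      (L.definableFun_const _ (mem_univ y'))
  have hcmono : MonotoneOn c (Icc x x') := by
    intro u hu t ht hut
    refine min_le_min ?_ le_rfl
    have e1 := mul_le_mul_of_nonneg_left (hf (hI hu) (hI ht) hut) (sub_nonneg.2 hs1.le)
    have e2 := mul_le_mul_of_nonneg_left (hg (hI hu) (hI ht) hut) hs0.le
    linarith
  have hcb : ∀ u ∈ Icc x x', f u < c u ∧ c u < g u := by
    intro u hu
    have e0 := sub_pos.2 (hfg u (hI hu))
    have e1 := mul_pos hs0 e0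
    have e2 := mul_pos (sub_pos.2 hs1) e0
    exact ⟨lt_min (by linarith) (by linarith [hf (hI hu) hx' hu.2]),
      (min_le_left _ _).trans_lt (by linarith)⟩
  have e1 := hk.abs_sub_le_of_curve hR hJ hf hg hfc hgc hkdef hcdef hx hx' hxx hcmono hcb
  have e2 := hk.vertical x' hx' (c x') y' (min_le_right _ _) (hcb x' hxI').1 h4
  have e3 := abs_sub_le (k x' y') (k x' (c x')) (k x (c x))
  rw [hcx] at e1 e3
  rw [abs_of_pos (sub_pos.2 hy)]
  linarith

theorem abs_sub_le (hk : LipschitzOnSegments J f g k) (hR : IsOMinimalField L R)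
    (hJ : J.OrdConnected) (hf : MonotoneOn f J ∨ AntitoneOn f J)
    (hg : MonotoneOn g J ∨ AntitoneOn g J)
    (hfc : ContinuousOn f J) (hgc : ContinuousOn g J)
    (hfdef : (univ : Set R).DefinableFun L (fun v : Fin 1 → R => f (v 0)))
    (hgdef : (univ : Set R).DefinableFun L (fun v : Fin 1 → R => g (v 0)))
    (hkdef : (univ : Set R).DefinableFun L (fun v : Fin 2 → R => k (v 0) (v 1)))
    (hfg : ∀ x ∈ J, f x < g x)
    {x x' y y' : R} (hx : x ∈ J) (hx' : x' ∈ J)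
    (h1 : f x < y) (h2 : y < g x) (h3 : f x' < y') (h4 : y' < g x') :
    |k x' y' - k x y| ≤ |x' - x| + |y' - y| := by
  wlog hxx : x ≤ x' generalizing x x' y y'
  · have := this hx' hx h3 h4 h1 h2 (le_of_not_ge hxx)
    rwa [abs_sub_comm, abs_sub_comm x', abs_sub_comm y']
  have hI := hJ.out hx hx'
  rw [abs_of_nonneg (sub_nonneg.2 hxx)]
  rcases hf with hf | hf <;> rcases hg with hg | hg
  · exact hk.abs_sub_le_of_monotoneOn hR hJ hf hg hfc hgc hfdef hgdef hkdef hfg hx hx' hxx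
      h1 h2 h3 h4
  -- The fibres shrink to the right, so the height `y'` is admissible over all of `[x, x']`; in the
  -- next case they grow, and `y` is.
  · refine hk.abs_sub_le_left hxx (fun u hu => ⟨hI hu, ?_, ?_⟩) h1 h2
    · linarith [hf (hI hu) hx' hu.2]
    · linarith [hg (hI hu) hx' hu.2]
  · refine hk.abs_sub_le_right hxx (fun u hu => ⟨hI hu, ?_, ?_⟩) h3 h4
    · linarith [hf hx (hI hu) hu.1]
    · linarith [hg hx (hI hu) hu.1]
  · have hkdef' : (univ : Set R).DefinableFun L (fun v : Fin 2 → R => k (v 0) (-v 1)) := by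
      have hM : (univ : Set R).DefinableMap L (fun v : Fin 2 → R => ![v 0, - v 1]) := by
        simp [Set.DefinableMap, hR.definableFun_neg, Set.DefinableFun.proj]
      exact Set.DefinableFun.comp hM hkdef
    have := hk.reflect.abs_sub_le_of_monotoneOn hR hJ hg.neg hf.neg hgc.neg hfc.neg
      (hR.definableFun_neg hgdef) (hR.definableFun_neg hfdef) hkdef'
      (fun u hu => neg_lt_neg (hfg u hu)) hx hx' hxx (y := -y) (y' := -y')
      (neg_lt_neg h2) (neg_lt_neg h1) (neg_lt_neg h4) (neg_lt_neg h3)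
    rw [neg_neg, neg_neg] at this
    rwa [show -y' - -y = -(y' - y) by ring, abs_neg] at this

end LipschitzOnSegments
end Cell
-- The `ℓ¹` distance, closures and Lipschitz extension
section SumDist

variable {R : Type w} [Field R] [LinearOrder R]

/-- The distance of the `ℓ¹` norm on `R ^ n`. -/
def sumDist {n : ℕ} (p q : Fin n → R) : R := ∑ i, |p i - q i|

variable [IsStrictOrderedRing R] {n : ℕ}

theorem sumDist_self (p : Fin n → R) : sumDist p p = 0 := by simp [sumDist]

theorem sumDist_comm (p q : Fin n → R) : sumDist p q = sumDist q p := by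
  simp [sumDist, abs_sub_comm]

theorem sumDist_nonneg (p q : Fin n → R) : 0 ≤ sumDist p q :=
  Finset.sum_nonneg fun _ _ => abs_nonneg _

theorem sumDist_triangle (p q r : Fin n → R) : sumDist p r ≤ sumDist p q + sumDist q r := by
  rw [sumDist, sumDist, sumDist, ← Finset.sum_add_distrib]
  exact Finset.sum_le_sum fun i _ => abs_sub_le _ _ _

theorem abs_sub_le_sumDist (p q : Fin n → R) (i : Fin n) : |p i - q i| ≤ sumDist p q :=
  Finset.single_le_sum (f := fun i => |p i - q i|) (fun _ _ => abs_nonneg _) (Finset.mem_univ i)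

section Topology

variable [TopologicalSpace R] [OrderTopology R]

theorem continuous_sumDist : Continuous fun pq : (Fin n → R) × (Fin n → R) =>
    sumDist pq.1 pq.2 := by
  unfold sumDist
  fun_prop

theorem nhds_basis_sumDist (p : Fin n → R) :
    (𝓝 p).HasBasis (fun ε : R => 0 < ε) fun ε => {q | sumDist q p < ε} := by
  have h : 𝓝 p = comap (fun q => sumDist q p) (𝓝 0) := by
    refine le_antisymm ?_ ?_
    · rw [← tendsto_iff_comap, ← sumDist_self p]
      exact (continuous_sumDist.comp (by fun_prop : Continuous fun q => (q, p))).tendsto p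
    · rw [← tendsto_id']
      refine tendsto_pi_nhds.2 fun i => ?_
      rw [LinearOrderedAddCommGroup.tendsto_nhds]
      intro ε hε
      filter_upwards [tendsto_comap.eventually_lt_const hε] with q hq
      exact (abs_sub_le_sumDist q p i).trans_lt hq
  rw [h]
  convert! (nhds_basis_abs_sub_lt (0 : R)).comap (fun q => sumDist q p) using 2 with ε
  ext q
  simp [abs_of_nonneg (sumDist_nonneg q p)]

theorem mem_closure_iff_sumDist {X : Set (Fin n → R)} {p : Fin n → R} :
    p ∈ closure X ↔ ∀ ε > 0, ∃ q ∈ X, sumDist q p < ε := by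
  simpa using mem_closure_iff_nhds_basis (nhds_basis_sumDist p) (t := X)

theorem continuous_of_abs_sub_le_sumDist {H : (Fin n → R) → R}
    (hH : ∀ p q, |H p - H q| ≤ sumDist p q) : Continuous H := by
  refine continuous_iff_continuousAt.2 fun p => ?_
  exact ((nhds_basis_sumDist p).tendsto_iff (nhds_basis_abs_sub_lt (H p))).2 fun ε hε =>
    ⟨ε, hε, fun q hq => (hH q p).trans_lt hq⟩

/-- Both sides are continuous in the pair `(a, b)`, so the inequality passes to the closure of `X ×ˢ
X`. -/
theorem abs_sub_le_sumDist_of_mem_closure {X : Set (Fin n → R)} {H : (Fin n → R) → R}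
    (hH : ContinuousOn H (closure X)) (hX : ∀ a ∈ X, ∀ b ∈ X, |H a - H b| ≤ sumDist a b)
    {a b : Fin n → R} (ha : a ∈ closure X) (hb : b ∈ closure X) :
    |H a - H b| ≤ sumDist a b := by
  have hmem : (a, b) ∈ closure (X ×ˢ X) := by
    rw [closure_prod_eq]
    exact ⟨ha, hb⟩
  have h1 : ContinuousWithinAt (fun pq : (Fin n → R) × (Fin n → R) => H pq.1 - H pq.2)
      (X ×ˢ X) (a, b) := by
    refine ContinuousWithinAt.sub ?_ ?_
    · exact ((hH a ha).mono subset_closure).comp (t := X) continuous_fst.continuousWithinAt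
        fun pq h => h.1
    · exact ((hH b hb).mono subset_closure).comp (t := X) continuous_snd.continuousWithinAt
        fun pq h => h.2
  exact ContinuousWithinAt.closure_le hmem h1.abs
    (continuous_sumDist.continuousWithinAt) fun pq h => hX _ h.1 _ h.2

end Topology

section Definability

variable {L : FirstOrder.Language.{u, v}} [L.Structure R]

theorem IsOMinimalField.definableFun_sum (hR : IsOMinimalField L R) {α ι : Type*} (s : Finset ι)
    {F : ι → (α → R) → R} (hF : ∀ i, (univ : Set R).DefinableFun L (F i)) :
    (univ : Set R).DefinableFun L (fun v => ∑ i ∈ s, F i v) := by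
  classical
  induction s using Finset.induction_on with
  | empty => simpa using L.definableFun_const α (mem_univ (0 : R))
  | insert i s hi ih => simpa [Finset.sum_insert hi] using hR.definableFun_add (hF i) ih

theorem IsOMinimalField.definableFun_sumDist (hR : IsOMinimalField L R) {α : Type*}
    {F G : (α → R) → Fin n → R} (hF : (univ : Set R).DefinableMap L F)
    (hG : (univ : Set R).DefinableMap L G) :
    (univ : Set R).DefinableFun L (fun v => sumDist (F v) (G v)) :=
  hR.definableFun_sum _ fun i => hR.definableFun_abs (hR.definableFun_sub (hF i) (hG i))

/-- The `ε`-description of the closure by `ℓ¹` balls is first order. In the index type, `inl (inl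
i)` carries the point, `inl (inr 0)` carries `ε`, and `inr i` the nearby point of `X`. -/
theorem IsOMinimalField.definable_closure [TopologicalSpace R] [OrderTopology R]
    (hR : IsOMinimalField L R) {X : Set (Fin n → R)} (hX : (univ : Set R).Definable L X) :
    (univ : Set R).Definable L (closure X) := by
  have hdist : (univ : Set R).Definable L {w : (Fin n ⊕ Fin 1) ⊕ Fin n → R |
      sumDist (fun i => w (.inr i)) (fun i => w (.inl (.inl i))) < w (.inl (.inr 0))} :=
    hR.definable_setOf_lt (hR.definableFun_sumDist (fun i => Set.DefinableFun.proj L)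
      (fun i => Set.DefinableFun.proj L)) (Set.DefinableFun.proj L)
  have h1 := Set.Definable.exists_of_finite ((hX.preimage_comp Sum.inr).inter hdist)
  have h2 : (univ : Set R).Definable L {w : Fin n ⊕ Fin 1 → R | 0 < w (.inr 0)} :=
    hR.definable_setOf_lt (L.definableFun_const _ (mem_univ 0)) (Set.DefinableFun.proj L)
  have h3 := Set.Definable.forall_of_finite (h2.himp h1)
  convert! h3 using 1
  ext p
  simp only [mem_closure_iff_sumDist, himp_eq, mem_ofPred_eq, mem_union, mem_inter_iff, mem_compl_iff,
    mem_preimage, Sum.elim_inl, Sum.elim_inr, sup_eq_union]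
  constructor
  · intro h u
    by_cases hu : 0 < u 0
    · exact Or.inl (h _ hu)
    · exact Or.inr hu
  · intro h ε hε
    exact (h fun _ => ε).resolve_right (not_not.2 hε)

theorem definableFunOn_of_definableFun {R : Type w} [L.Structure R] {n : ℕ} {X : Set (Fin n → R)}
    {H : (Fin n → R) → R}
    (hX : (univ : Set R).Definable L X) (hH : (univ : Set R).DefinableFun L H) :
    DefinableFunOn L X H := by
  have h1 := hX.preimage_comp (Fin.castSucc : Fin n → Fin (n + 1))
  have h2 : (univ : Set R).DefinableFun L (fun p : Fin (n + 1) → R => H (fun i => p i.castSucc)) :=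
    Set.DefinableFun.comp (fun i => Set.DefinableFun.proj L) hH
  exact h1.inter (Set.DefinableFun.ofPred_eq (Set.DefinableFun.proj L (i := Fin.last n)) h2)

/-- A definable Lipschitz function on a definable set extends to a definable Lipschitz function:
the extension of McShane. -/
theorem IsOMinimalField.exists_lipschitz_extension (hR : IsOMinimalField L R)
    {X : Set (Fin n → R)} {h : (Fin n → R) → R} (hdef : DefinableFunOn L X h) (hne : X.Nonempty)
    (hlip : ∀ a ∈ X, ∀ b ∈ X, |h a - h b| ≤ sumDist a b) :
    ∃ H : (Fin n → R) → R, (univ : Set R).DefinableFun L H ∧ EqOn H h X ∧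
      ∀ p q, |H p - H q| ≤ sumDist p q := by
  have hX := definableFunOn_domain hdef
  have hind := hdef.indicator
  set T : (Fin n → R) → Set R := fun p => {y | ∃ q ∈ X, y = X.indicator h q + sumDist p q} with hT
  have hTdef : ∀ p, (univ : Set R).Definable₁ L (T p) := by
    intro p
    have h1 : (univ : Set R).DefinableFun L (fun w : Fin 1 ⊕ Fin n → R =>
        X.indicator h (fun i => w (.inr i)) + sumDist p (fun i => w (.inr i))) :=
      hR.definableFun_add (Set.DefinableFun.comp (fun i => Set.DefinableFun.proj L) hind)
        (hR.definableFun_sumDist (fun i => L.definableFun_const _ (mem_univ (p i)))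
          (fun i => Set.DefinableFun.proj L))
    exact Set.Definable.exists_of_finite ((hX.preimage_comp Sum.inr).inter
      (Set.DefinableFun.ofPred_eq (Set.DefinableFun.proj L (i := Sum.inl 0)) h1))
  have hTne : ∀ p, (T p).Nonempty := fun p => ⟨_, hne.some, hne.some_mem, rfl⟩
  have hTb : ∀ p, BddBelow (T p) := by
    intro p
    obtain ⟨q₀, hq₀⟩ := hne
    -- The Lipschitz bound between `q₀` and `q`, with the triangle inequality through `p`, makes
    -- this a lower bound.
    refine ⟨h q₀ - sumDist p q₀, ?_⟩
    rintro _ ⟨q, hq, rfl⟩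
    rw [indicator_of_mem hq]
    have e1 := (abs_le.1 (hlip q₀ hq₀ q hq)).2
    have e2 := sumDist_triangle q₀ p q
    rw [sumDist_comm q₀ p] at e2
    linarith
  choose H hH using fun p => hR.exists_isGLB (hTdef p) (hTne p) (hTb p)
  refine ⟨H, ?_, ?_, ?_⟩
  -- The graph of `H` is described in first-order terms: the value, in coordinate `none`, is a lower
  -- bound of `T p` and dominates every lower bound.
  · have h1 : (univ : Set R).DefinableFun L (fun w : Option (Fin n) ⊕ Fin n → R =>
        X.indicator h (fun i => w (.inr i)) +
          sumDist (fun i => w (.inl (some i))) (fun i => w (.inr i))) :=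
      hR.definableFun_add (Set.DefinableFun.comp (fun i => Set.DefinableFun.proj L) hind)
        (hR.definableFun_sumDist (fun i => Set.DefinableFun.proj L)
          (fun i => Set.DefinableFun.proj L))
    have hlow : (univ : Set R).Definable L
        {w : Option (Fin n) → R | w none ∈ lowerBounds (T fun i => w (some i))} := by
      have := Set.Definable.forall_of_finite ((hX.preimage_comp Sum.inr).himp
        (hR.definable_setOf_le (Set.DefinableFun.proj L (i := Sum.inl none)) h1))
      convert! this using 1
      ext w
      simp only [hT, mem_lowerBounds, himp_eq, mem_ofPred_eq, mem_union, mem_compl_iff, mem_preimage,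
        sup_eq_union, Sum.elim_inl, Sum.elim_inr]
      constructor
      · intro hw q
        by_cases hq : q ∈ X
        · exact Or.inl (hw _ ⟨q, hq, rfl⟩)
        · exact Or.inr hq
      · rintro hw _ ⟨q, hq, rfl⟩
        exact (hw q).resolve_right (not_not.2 hq)
    have hgreatest := Set.Definable.forall_of_finite ((hlow.preimage_comp
      (fun o : Option (Fin n) => (o.elim (.inr 0) (fun i => .inl (some i)) :
        Option (Fin n) ⊕ Fin 1))).himp
      (hR.definable_setOf_le (Set.DefinableFun.proj L (i := Sum.inr 0))
        (Set.DefinableFun.proj L (i := Sum.inl none))))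
    have hgraph := hlow.inter hgreatest
    unfold Set.DefinableFun
    convert! hgraph using 1
    ext w
    simp only [Function.tupleGraph, himp_eq, mem_ofPred_eq, mem_union, mem_compl_iff, mem_preimage,
      sup_eq_union, Sum.elim_inl, Sum.elim_inr, mem_inter_iff, Function.comp_apply, Option.elim]
    constructor
    · intro hw
      have hg := hH (w ∘ some)
      rw [hw] at hg
      refine ⟨hg.1, fun u => ?_⟩
      by_cases hu : u 0 ∈ lowerBounds (T (w ∘ some))
      · exact Or.inl (hg.2 hu)
      · exact Or.inr hu
    · rintro ⟨hw1, hw2⟩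
      refine (hH (w ∘ some)).unique ⟨hw1, fun z hz => ?_⟩
      exact (hw2 fun _ => z).resolve_right (not_not.2 hz)
  -- At `p ∈ X` the infimum is attained at `q = p`; the Lipschitz bound makes `h p` a lower bound.
  · intro p hp
    refine (hH p).unique ⟨?_, fun z hz => ?_⟩
    · rintro _ ⟨q, hq, rfl⟩
      rw [indicator_of_mem hq]
      linarith [(abs_le.1 (hlip p hp q hq)).2]
    · simpa [indicator_of_mem hp, sumDist_self] using hz ⟨p, hp, rfl⟩
  · have key : ∀ p q, H p ≤ H q + sumDist p q := by
      intro p q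
      have : H p - sumDist p q ≤ H q := by
        refine (hH q).2 ?_
        rintro _ ⟨r, hr, rfl⟩
        have e1 := (hH p).1 ⟨r, hr, rfl⟩
        linarith [sumDist_triangle p q r]
      linarith
    intro p q
    have e := key q p
    rw [sumDist_comm] at e
    exact abs_le.2 ⟨by linarith, by linarith [key p q]⟩

end Definability
end SumDist

/-! ### Infinitesimals and standard parts -/

section ConvexSubring

variable {R : Type w} [Field R] [LinearOrder R] [IsStrictOrderedRing R]
  {V : ProperConvexSubring R}

namespace ProperConvexSubring

theorem mem_of_abs_le {x y : R} (hy : y ∈ V.toValuationSubring) (hxy : |x| ≤ y) :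
    x ∈ V.toValuationSubring :=
  V.convex.out (V.toSubring.neg_mem hy) hy (abs_le.1 hxy)

/-- The maximal ideal consists of the nonunits of `V`. Since `0⁻¹ = 0` lies in `V`, zero has to be
admitted separately. -/
theorem mem_infinitesimals_iff {x : R} :
    x ∈ V.infinitesimals ↔ x ∈ V.toValuationSubring ∧
      (x⁻¹ ∈ V.toValuationSubring → x = 0) := by
  constructor
  · rintro ⟨hx, hmem⟩
    refine ⟨hx, fun hinv => by_contra fun h0 => ?_⟩
    refine (IsLocalRing.mem_maximalIdeal _).1 hmem ?_
    exact IsUnit.of_mul_eq_one (⟨x⁻¹, hinv⟩ : V.toValuationSubring)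
      (Subtype.ext (mul_inv_cancel₀ h0))
  · rintro ⟨hx, hinv⟩
    refine ⟨hx, (IsLocalRing.mem_maximalIdeal _).2 fun hu => ?_⟩
    obtain ⟨y, hy⟩ := hu.exists_right_inv
    have hxy : x * (y : R) = 1 := congrArg Subtype.val hy
    have h0 : x ≠ 0 := left_ne_zero_of_mul_eq_one hxy
    exact h0 (hinv ((eq_inv_of_mul_eq_one_right hxy) ▸ y.2))

theorem add_mem_infinitesimals {x y : R} (hx : x ∈ V.infinitesimals)
    (hy : y ∈ V.infinitesimals) : x + y ∈ V.infinitesimals :=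
  ⟨add_mem hx.1 hy.1, Ideal.add_mem _ hx.2 hy.2⟩

/-- If `x ≠ 0` had its inverse in `V`, then `|y⁻¹| ≤ |x⁻¹|` would put `y⁻¹` in `V` by convexity,
forcing `y = 0` and so `x = 0`. -/
theorem mem_infinitesimals_of_abs_le {x y : R} (hy : y ∈ V.infinitesimals) (hxy : |x| ≤ |y|) :
    x ∈ V.infinitesimals := by
  rw [mem_infinitesimals_iff] at hy ⊢
  have habs : ∀ {z : R}, z ∈ V.toValuationSubring → |z| ∈ V.toValuationSubring := fun {z} hz => by
    rcases abs_choice z with h | h <;> rw [h]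
    · exact hz
    · exact neg_mem hz
  refine ⟨mem_of_abs_le (habs hy.1) hxy, fun hinv => by_contra fun h0 => ?_⟩
  have hy0 : y = 0 := hy.2 <| mem_of_abs_le (habs hinv) <| by
    rw [abs_inv, abs_inv]
    exact inv_anti₀ (abs_pos.2 h0) hxy
  rw [hy0, abs_zero] at hxy
  exact h0 (abs_nonpos_iff.1 hxy)

theorem abs_mem_infinitesimals {x : R} (hx : x ∈ V.infinitesimals) : |x| ∈ V.infinitesimals :=
  mem_infinitesimals_of_abs_le hx (abs_abs x).le

theorem sameSt_iff {a b : R} : V.SameSt a b ↔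
    a ∈ V.toValuationSubring ∧ b ∈ V.toValuationSubring ∧ a - b ∈ V.infinitesimals := by
  have key : ∀ (ha : a ∈ V.toValuationSubring) (hb : b ∈ V.toValuationSubring),
      V.st ⟨a, ha⟩ = V.st ⟨b, hb⟩ ↔ a - b ∈ V.infinitesimals := by
    intro ha hb
    rw [← sub_eq_zero, ← map_sub, st, IsLocalRing.residue_eq_zero_iff]
    exact ⟨fun h => ⟨sub_mem ha hb, h⟩, fun h => h.2⟩
  exact ⟨fun ⟨ha, hb, h⟩ => ⟨ha, hb, (key ha hb).1 h⟩,
    fun ⟨ha, hb, h⟩ => ⟨ha, hb, (key ha hb).2 h⟩⟩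

theorem sameSt_of_sub_mem {a b : R} (ha : a ∈ V.toValuationSubring)
    (hab : a - b ∈ V.infinitesimals) : V.SameSt a b := by
  refine sameSt_iff.2 ⟨ha, ?_, hab⟩
  simpa using sub_mem ha hab.1

theorem sub_mem_infinitesimals_of_le_sumDist {n : ℕ} {a b : Fin n → R} {x y : R}
    (hab : ∀ i, V.SameSt (a i) (b i)) (hxy : |x - y| ≤ sumDist a b) :
    x - y ∈ V.infinitesimals := by
  have hsum : ∀ s : Finset (Fin n), ∑ i ∈ s, |a i - b i| ∈ V.infinitesimals := by
    intro s
    induction s using Finset.induction_on with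
    | empty => simp [mem_infinitesimals_iff, zero_mem]
    | insert i s hi ih =>
      rw [Finset.sum_insert hi]
      exact add_mem_infinitesimals (abs_mem_infinitesimals (sameSt_iff.1 (hab i)).2.2) ih
  exact mem_infinitesimals_of_abs_le (hsum Finset.univ) (hxy.trans (le_abs_self _))

end ProperConvexSubring
end ConvexSubring

/-! ### The Lipschitz estimate for `h` on the cell -/

section Cell

variable {R : Type w} [Field R] [LinearOrder R]

theorem IsOpenInterval.ordConnected {J : Set R} (hJ : IsOpenInterval J) : J.OrdConnected := by
  obtain ⟨-, α, β, rfl⟩ := hJ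
  have hle : ∀ {a b : R}, a ≤ b → ((a : WithTop R) : WithBot (WithTop R)) ≤ ((b : WithTop R) :) :=
    fun hab => WithBot.coe_le_coe.2 (WithTop.coe_le_coe.2 hab)
  exact ⟨fun a ha b hb x hx => ⟨ha.1.trans_le (hle hx.1), (hle hx.2).trans_lt hb.2⟩⟩

variable [IsStrictOrderedRing R] [TopologicalSpace R] [OrderTopology R]
  {L : FirstOrder.Language.{u, v}} [L.Structure R] {J : Set R} {f g f' g' : R → R}

theorem DefinableFunOn₁.indicator (hf : DefinableFunOn₁ L J f) :
    (univ : Set R).DefinableFun L (fun v : Fin 1 → R => J.indicator f (v 0)) := by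
  convert! DefinableFunOn.indicator hf using 1

theorem IsOMinimalField.monotoneOn_or_antitoneOn (hR : IsOMinimalField L R)
    (hJ : J.OrdConnected) (hfdef : DefinableFunOn₁ L J f) (hf : IsC1On₁ J f f')
    (hf' : ConstantSignOn J f') :
    MonotoneOn (J.indicator f) J ∨ AntitoneOn (J.indicator f) J := by
  have heq : EqOn f (J.indicator f) J := fun x hx => (indicator_of_mem hx f).symm
  exact hf'.imp
    (fun h => (hR.monotoneOn_of_hasDerivR_nonneg hJ hfdef.indicator hf.1 h).congr heq)
    (fun h => (hR.antitoneOn_of_hasDerivR_nonpos hJ hfdef.indicator hf.1 h).congr heq)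

/-- A definable function with partial derivatives bounded by `1` on a cell between monotone
functions is `1`-Lipschitz for the `ℓ¹` distance. -/
theorem IsTwoCell.abs_sub_le_sumDist (hR : IsOMinimalField L R) (hcell : IsTwoCell L J f g)
    (hf : IsC1On₁ J f f') (hg : IsC1On₁ J g g')
    (hf' : ConstantSignOn J f') (hg' : ConstantSignOn J g')
    {h : (Fin 2 → R) → R} {h' : Fin 2 → (Fin 2 → R) → R}
    (hdef : DefinableFunOn L (cellBetween J f g) h) (hC1 : IsC1On (cellBetween J f g) h h')
    (hlt : ∀ a ∈ cellBetween J f g, ∀ i, |h' i a| < 1) {a b : Fin 2 → R}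
    (ha : a ∈ cellBetween J f g) (hb : b ∈ cellBetween J f g) :
    |h a - h b| ≤ sumDist a b := by
  have hJ := hcell.isOpenInterval.ordConnected
  have hfe : EqOn (J.indicator f) f J := fun x hx => indicator_of_mem hx f
  have hge : EqOn (J.indicator g) g J := fun x hx => indicator_of_mem hx g
  have hseg := fun p i s t hst => hR.abs_update_sub_le hdef hC1.1 hlt p i (s := s) (t := t) hst
  have hupd0 : ∀ x y u : R, Function.update ![x, y] 0 u = ![u, y] := fun x y u => by
    ext i
    fin_cases i <;> simp
  have hupd1 : ∀ x y u : R, Function.update ![x, y] 1 u = ![x, u] := fun x y u => by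
    ext i
    fin_cases i <;> simp
  have hmem : ∀ x y : R, x ∈ J → J.indicator f x < y → y < J.indicator g x →
      ![x, y] ∈ cellBetween J f g := by
    intro x y hx h1 h2
    rw [hfe hx] at h1
    rw [hge hx] at h2
    exact ⟨hx, h1, h2⟩
  -- Total definable versions of `f`, `g` and `h` replace the originals; they agree with them on `J`
  -- and on the cell.
  set k : R → R → R := fun x y => (cellBetween J f g).indicator h ![x, y] with hk
  have hkeq : ∀ {x y : R}, ![x, y] ∈ cellBetween J f g → k x y = h ![x, y] :=
    fun hxy => indicator_of_mem hxy h
  have hkseg : LipschitzOnSegments J (J.indicator f) (J.indicator g) k := by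
    constructor
    · intro x x' y hxx hu
      have hC : ∀ u ∈ Icc x x', ![u, y] ∈ cellBetween J f g := fun u hu' =>
        hmem u y (hu u hu').1 (hu u hu').2.1 (hu u hu').2.2
      have := hseg ![x, y] 0 x x' hxx fun u hu' => by
        rw [hupd0]
        exact hC u hu'
      rwa [hupd0, hupd0, ← hkeq (hC _ (left_mem_Icc.2 hxx)),
        ← hkeq (hC _ (right_mem_Icc.2 hxx))] at this
    · intro x hx y y' hyy h1 h2
      have hC : ∀ u ∈ Icc y y', ![x, u] ∈ cellBetween J f g := fun u hu' =>
        hmem x u hx (h1.trans_le hu'.1) (hu'.2.trans_lt h2)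
      have := hseg ![x, y] 1 y y' hyy fun u hu' => by
        rw [hupd1]
        exact hC u hu'
      rwa [hupd1, hupd1, ← hkeq (hC _ (left_mem_Icc.2 hyy)),
        ← hkeq (hC _ (right_mem_Icc.2 hyy))] at this
  have hkdef : (univ : Set R).DefinableFun L (fun v : Fin 2 → R => k (v 0) (v 1)) := by
    have hM : (univ : Set R).DefinableMap L (fun v : Fin 2 → R => ![v 0, v 1]) := by
      simp [Set.DefinableMap, Set.DefinableFun.proj]
    exact Set.DefinableFun.comp hM hdef.indicator
  have hpt : ∀ p ∈ cellBetween J f g, J.indicator f (p 0) < p 1 ∧ p 1 < J.indicator g (p 0) ∧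
      k (p 0) (p 1) = h p := by
    intro p hp
    have hp2 : ![p 0, p 1] = p := by
      ext i
      fin_cases i <;> rfl
    refine ⟨?_, ?_, ?_⟩
    · rw [hfe hp.1]
      exact hp.2.1
    · rw [hge hp.1]
      exact hp.2.2
    · rw [hkeq (by rwa [hp2]), hp2]
  obtain ⟨a1, a2, a3⟩ := hpt a ha
  obtain ⟨b1, b2, b3⟩ := hpt b hb
  have := hkseg.abs_sub_le hR hJ
    (hR.monotoneOn_or_antitoneOn hJ hcell.definable_lower hf hf')
    (hR.monotoneOn_or_antitoneOn hJ hcell.definable_upper hg hg')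
    (hcell.continuousOn_lower.congr hfe) (hcell.continuousOn_upper.congr hge)
    hcell.definable_lower.indicator hcell.definable_upper.indicator hkdef
    (fun x hx => by
      rw [hfe hx, hge hx]
      exact hcell.lt x hx) hb.1 ha.1 b1 b2 a1 a2
  rw [a3, b3] at this
  rwa [sumDist, Fin.sum_univ_two]

theorem IsTwoCell.nonempty (hcell : IsTwoCell L J f g) : (cellBetween J f g).Nonempty := by
  obtain ⟨x, hx⟩ := hcell.isOpenInterval.1
  obtain ⟨y, h1, h2⟩ := exists_between (hcell.lt x hx)
  exact ⟨![x, y], hx, h1, h2⟩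

end Cell
end ResidueOMin

/-! ### The theorem -/

theorem lemma3p5 {R : Type w} [Field R] [LinearOrder R] [IsStrictOrderedRing R] [IsRealClosed R]
    [TopologicalSpace R] [OrderTopology R]
    (L : FirstOrder.Language.{u, v}) [L.Structure R]
    (hR : ResidueOMin.IsOMinimalField L R)
    (V : ResidueOMin.ProperConvexSubring R)
    (J : Set R) (f g f' g' : R → R)
    (hcell : ResidueOMin.IsTwoCell L J f g)
    (hCV : ResidueOMin.cellBetween J f g ⊆ V.power 2)
    (hf : ResidueOMin.IsC1On₁ J f f') (hg : ResidueOMin.IsC1On₁ J g g')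
    (hf' : ResidueOMin.ConstantSignOn J f') (hg' : ResidueOMin.ConstantSignOn J g')
    (h : (Fin 2 → R) → R) (h' : Fin 2 → (Fin 2 → R) → R)
    (hdef : ResidueOMin.DefinableFunOn L (ResidueOMin.cellBetween J f g) h)
    (hC1 : ResidueOMin.IsC1On (ResidueOMin.cellBetween J f g) h h')
    (hlt : ∀ a ∈ ResidueOMin.cellBetween J f g, ∀ i, |h' i a| < 1) :
    -- infinitely close points of the cell have infinitely close values
    (∀ a ∈ ResidueOMin.cellBetween J f g, ∀ b ∈ ResidueOMin.cellBetween J f g,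
      (∀ i, V.SameSt (a i) (b i)) →
        h a - h b ∈ V.infinitesimals ∧ (h a ∈ V.toValuationSubring → V.SameSt (h a) (h b))) ∧
    -- the same for a continuous extension to the closure, if there is one
    (∀ H : (Fin 2 → R) → R, ContinuousOn H (closure (ResidueOMin.cellBetween J f g)) →
      EqOn H h (ResidueOMin.cellBetween J f g) →
      ∀ a ∈ closure (ResidueOMin.cellBetween J f g),
      ∀ b ∈ closure (ResidueOMin.cellBetween J f g),
      (∀ i, V.SameSt (a i) (b i)) →
        H a - H b ∈ V.infinitesimals ∧ (H a ∈ V.toValuationSubring → V.SameSt (H a) (H b))) ∧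
    -- if the graph lies in `V ^ 3`, standard parts of values agree and `h` extends
    (ResidueOMin.graphOn (ResidueOMin.cellBetween J f g) h ⊆ V.power 3 →
      (∀ a ∈ ResidueOMin.cellBetween J f g, ∀ b ∈ ResidueOMin.cellBetween J f g,
        (∀ i, V.SameSt (a i) (b i)) → V.SameSt (h a) (h b)) ∧
      ∃ H : (Fin 2 → R) → R,
        ResidueOMin.DefinableFunOn L (closure (ResidueOMin.cellBetween J f g)) H ∧
        ContinuousOn H (closure (ResidueOMin.cellBetween J f g)) ∧
        EqOn H h (ResidueOMin.cellBetween J f g)) := by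
  have hlip : ∀ a ∈ ResidueOMin.cellBetween J f g, ∀ b ∈ ResidueOMin.cellBetween J f g,
      |h a - h b| ≤ ResidueOMin.sumDist a b :=
    fun a ha b hb => hcell.abs_sub_le_sumDist hR hf hg hf' hg' hdef hC1 hlt ha hb
  refine ⟨fun a ha b hb hab => ?_, fun H hH hHh a ha b hb hab => ?_, fun hV => ⟨?_, ?_⟩⟩
  · have hmem := ResidueOMin.ProperConvexSubring.sub_mem_infinitesimals_of_le_sumDist hab
      (hlip a ha b hb)
    exact ⟨hmem, fun hha => ResidueOMin.ProperConvexSubring.sameSt_of_sub_mem hha hmem⟩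
  · have hmem := ResidueOMin.ProperConvexSubring.sub_mem_infinitesimals_of_le_sumDist hab
      (ResidueOMin.abs_sub_le_sumDist_of_mem_closure hH (fun p hp q hq => by
        rw [hHh hp, hHh hq]
        exact hlip p hp q hq) ha hb)
    exact ⟨hmem, fun hHa => ResidueOMin.ProperConvexSubring.sameSt_of_sub_mem hHa hmem⟩
  · intro a ha b hb hab
    -- The last coordinate of the graph point over `a` shows that `h a` lies in `V`.
    have hmem : (Fin.snoc a (h a) : Fin 3 → R) ∈ V.power 3 :=
      hV ⟨by simpa using ha, by
        rw [Fin.snoc_last, Fin.init_snoc]⟩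
    have hha := hmem (Fin.last 2)
    rw [Fin.snoc_last] at hha
    exact ResidueOMin.ProperConvexSubring.sameSt_of_sub_mem hha
      (ResidueOMin.ProperConvexSubring.sub_mem_infinitesimals_of_le_sumDist hab (hlip a ha b hb))
  · obtain ⟨H, hHdef, hHh, hHlip⟩ := hR.exists_lipschitz_extension hdef hcell.nonempty hlip
    exact ⟨H, ResidueOMin.definableFunOn_of_definableFun
      (hR.definable_closure (ResidueOMin.definableFunOn_domain hdef)) hHdef,
      (ResidueOMin.continuous_of_abs_sub_le_sumDist hHlip).continuousOn, hHh⟩
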